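/- Let $G$ be a finite simple graph that is chordal, i.e. for no $n\ge 4$ does $G$ contain a chordless cycle of length $n$ as an induced subgraph. Then $G$ is an interval graph (the intersection graph of a family of intervals of the real line) if and only if $G$ contains no asteroidal triple. Here an asteroidal triple is a set of three distinct, pairwise non-adjacent vertices such that any two of them are joined by a path in $G$ that contains no neighbor of the third. -/

import Mathlib

namespace SimpleGraph

/-- A graph is chordal if it contains no hole as an induced subgraph; a hole is a chordless cycle
of length at least four. -/
def IsChordal {V : Type*} (G : SimpleGraph V) : Prop :=
  ∀ n : ℕ, 4 ≤ n → ¬ (cycleGraph n).IsIndContained G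

/-- `G` is the intersection graph of the family of sets `F`, indexed by the vertices of `G`:
two distinct vertices are adjacent exactly when their sets intersect. -/
def IsIntersectionGraph {V α : Type*} (G : SimpleGraph V) (F : V → Set α) : Prop :=
  ∀ u v : V, u ≠ v → (G.Adj u v ↔ (F u ∩ F v).Nonempty)

/-- An interval graph is the intersection graph of a family of (nonempty) intervals of the real
line. Intervals may be open, closed or half-open, and bounded or unbounded. -/
def IsIntervalGraph {V : Type*} (G : SimpleGraph V) : Prop :=
  ∃ I : V → Set ℝ, (∀ v, (I v).Nonempty ∧ (I v).OrdConnected) ∧ G.IsIntersectionGraph I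

/-- An asteroidal triple is a set of three pairwise non-adjacent vertices such that any two of
them are joined by a path that contains no neighbor of the third. -/
def IsAsteroidalTriple {V : Type*} (G : SimpleGraph V) (s : Finset V) : Prop :=
  s.card = 3 ∧ G.IsIndepSet (s : Set V) ∧
    ∀ u ∈ s, ∀ v ∈ s, ∀ w ∈ s, u ≠ v → u ≠ w → v ≠ w →
      ∃ p : G.Walk u v, p.IsPath ∧ ∀ x ∈ p.support, x ∉ G.neighborSet w

end SimpleGraph

/-!
The Lekkerkerker–Boland theorem. In an interval graph, one of three pairwise disjoint intervals lies
between the other two, and a path from one side to the other meets the closed neighborhood of the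
middle vertex (`IsIntersectionGraph.not_lt_and_lt`).

For the converse, an interval representation is encoded by the relation "entirely before" on the
vertices: an irreflexive relation satisfying the Ferrers condition in which exactly the nonadjacent
pairs of distinct vertices are comparable (`IsPlacement`). Such a relation is produced by induction
on the number of vertices, for a stronger statement: two cliques `A` and `B` are prescribed at the
left and at the right end. The hypothesis on `A` and `B` (`IsAdmissible`) excludes the obstructions
of asteroidal type that appear when long paths are attached to `A` and to `B`.

If the graph is not complete, let `S` be a separating set of minimal size. By chordality `S` is a
clique, and by minimality each vertex of `S` has neighbors in all components of the graph minus `S`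
(`IsChordal.exists_isFullSeparator`). Hence if `s ∈ S` is not adjacent to `x`, then the components
other than that of `x` can be joined through `s` by paths missing the closed neighborhood of `x`.
In the absence of asteroidal triples it follows that at most two components contain a vertex that is
not adjacent to all of `S` (`joinedIn_or_joinedIn`), and similar arguments, taking `A` and `B` into
account, show that two components can be chosen as the left and the right side so that all other
components are complete to `S` (`exists_sides`). The left side together with `S` is
admissible for `A` and `S`, the right side together with `S` for `S` and `B`, and the remaining
vertices together with `S` for `S` and `S`. By induction these pieces have placements, which are
glued along `S` (`IsPlacement.glue`).
-/

namespace SimpleGraph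

variable {V : Type*} {G : SimpleGraph V}

/-! ### Walks inside a set of vertices -/

/-- `u` and `v` are the ends of a walk of `G` all of whose vertices lie in `X`. -/
def JoinedIn (G : SimpleGraph V) (X : Set V) (u v : V) : Prop :=
  ∃ p : G.Walk u v, ∀ x ∈ p.support, x ∈ X

namespace JoinedIn

variable {X Y : Set V} {u v w : V}

theorem refl (h : u ∈ X) : G.JoinedIn X u u := ⟨.nil, by simpa using h⟩

theorem symm (h : G.JoinedIn X u v) : G.JoinedIn X v u := by
  obtain ⟨p, hp⟩ := h
  exact ⟨p.reverse, by simpa using hp⟩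

theorem trans (h : G.JoinedIn X u v) (h' : G.JoinedIn X v w) : G.JoinedIn X u w := by
  obtain ⟨p, hp⟩ := h
  obtain ⟨q, hq⟩ := h'
  refine ⟨p.append q, fun x hx => ?_⟩
  rw [Walk.mem_support_append_iff] at hx
  exact hx.elim (hp x) (hq x)

theorem mono (hXY : X ⊆ Y) (h : G.JoinedIn X u v) : G.JoinedIn Y u v := by
  obtain ⟨p, hp⟩ := h
  exact ⟨p, fun x hx => hXY (hp x hx)⟩

theorem left_mem (h : G.JoinedIn X u v) : u ∈ X := by
  obtain ⟨p, hp⟩ := h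
  exact hp u p.start_mem_support

theorem right_mem (h : G.JoinedIn X u v) : v ∈ X := h.symm.left_mem

theorem of_adj (hu : u ∈ X) (hv : v ∈ X) (h : G.Adj u v) : G.JoinedIn X u v :=
  ⟨h.toWalk, by simp [hu, hv]⟩

/-- A walk inside `X` that starts in a subset `C` which no edge of `G` inside `X` leaves
stays inside `C`. -/
theorem of_closed {C : Set V} (hC : ∀ x ∈ C, ∀ y ∈ X, G.Adj x y → y ∈ C) (hu : u ∈ C)
    (h : G.JoinedIn X u v) : G.JoinedIn C u v := by
  obtain ⟨p, hp⟩ := h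
  induction p with
  | nil => exact refl hu
  | @cons a b c hab p ih =>
    have hb : b ∈ C := hC a hu b (hp b (by simp)) hab
    exact (of_adj hu hb hab).trans (ih hb fun x hx => hp x (by simp [hx]))

/-- The component of `u` in the subgraph induced on `X` is joined inside itself. -/
theorem in_component (h : G.JoinedIn X u v) : G.JoinedIn {x | G.JoinedIn X u x} u v :=
  h.of_closed (fun _ hx _ hy hxy => hx.trans (of_adj hx.right_mem hy hxy)) (refl h.left_mem)

/-- A shortest walk inside `X`, as a sequence of vertices: it is an induced path. -/
theorem exists_induced_path (h : G.JoinedIn X u v) :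
    ∃ (k : ℕ) (p : ℕ → V), p 0 = u ∧ p k = v ∧ (∀ i ≤ k, p i ∈ X) ∧
      ∀ i j, i < j → j ≤ k → p i ≠ p j ∧ (G.Adj (p i) (p j) ↔ j = i + 1) := by
  classical
  have hex : ∃ n, ∃ p : G.Walk u v, p.length = n ∧ ∀ x ∈ p.support, x ∈ X := by
    obtain ⟨p, hp⟩ := h
    exact ⟨_, p, rfl, hp⟩
  obtain ⟨p, hlen, hp⟩ := Nat.find_spec hex
  have hmin : ∀ q : G.Walk u v, (∀ x ∈ q.support, x ∈ X) → p.length ≤ q.length := by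
    intro q hq
    rw [hlen]
    exact Nat.find_min' hex ⟨q, rfl, hq⟩
  have htake : ∀ i, ∀ x ∈ (p.take i).support, x ∈ X := fun i x hx =>
    hp x ((p.isSubwalk_take i).support_subset hx)
  have hdrop : ∀ i, ∀ x ∈ (p.drop i).support, x ∈ X := fun i x hx =>
    hp x ((p.isSubwalk_drop i).support_subset hx)
  refine ⟨p.length, p.getVert, by simp, by simp, fun i _ => hp _ (p.getVert_mem_support i), ?_⟩
  intro i j hij hj
  refine ⟨fun heq => ?_, fun hadj => ?_, ?_⟩
  · -- a repeated vertex allows to cut out a closed subwalk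
    have := hmin ((p.take i).append ((p.drop j).copy heq.symm rfl)) fun x hx => by
      rw [Walk.mem_support_append_iff, Walk.support_copy] at hx
      exact hx.elim (htake i x) (hdrop j x)
    simp only [Walk.length_append, Walk.take_length, Walk.length_copy, Walk.drop_length] at this
    omega
  · -- a chord is a shortcut
    by_contra hne
    have := hmin ((p.take i).append (.cons hadj (p.drop j))) fun x hx => by
      rw [Walk.mem_support_append_iff, Walk.support_cons, List.mem_cons] at hx
      rcases hx with hx | rfl | hx
      · exact htake i x hx
      · exact hp _ (p.getVert_mem_support i)
      · exact hdrop j x hx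
    simp only [Walk.length_append, Walk.take_length, Walk.length_cons, Walk.drop_length] at this
    omega
  · rintro rfl
    exact p.adj_getVert_succ (by omega)

end JoinedIn

/-! ### Holes from pairs of paths -/

theorem cycleGraph_adj_of_lt {n : ℕ} (hn : 2 ≤ n) {i j : Fin n} (hij : i.val < j.val) :
    (cycleGraph n).Adj i j ↔ j.val = i.val + 1 ∨ (i.val = 0 ∧ j.val = n - 1) := by
  rw [cycleGraph_adj', Fin.coe_sub_iff_le.2 (show i ≤ j from hij.le), Fin.coe_sub_iff_lt.2 hij]
  have := j.isLt
  omega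

/-- An embedding of a cycle may be checked on pairs `i < j`. -/
theorem cycleGraph_isIndContained {n : ℕ} (hn : 2 ≤ n) (f : ℕ → V)
    (hf : ∀ i j, i < j → j < n →
      f i ≠ f j ∧ (G.Adj (f i) (f j) ↔ j = i + 1 ∨ (i = 0 ∧ j = n - 1))) :
    (cycleGraph n).IsIndContained G := by
  refine ⟨⟨⟨fun i => f i, fun i j h => ?_⟩, fun {i j} => ?_⟩⟩
  · by_contra hne
    rcases lt_or_gt_of_ne (Fin.val_ne_of_ne hne) with hlt | hlt
    · exact (hf i j hlt j.isLt).1 h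
    · exact (hf j i hlt i.isLt).1 h.symm
  · change G.Adj (f i) (f j) ↔ _
    rcases lt_trichotomy i.val j.val with hlt | heq | hlt
    · rw [(hf i j hlt j.isLt).2, cycleGraph_adj_of_lt hn hlt]
    · obtain rfl := Fin.ext heq
      simp
    · rw [G.adj_comm, (cycleGraph n).adj_comm, (hf j i hlt i.isLt).2, cycleGraph_adj_of_lt hn hlt]

/-- In a chordal graph, two vertices that can be joined through either of two sets without an
edge between them are adjacent: otherwise two shortest such paths form a hole. -/
theorem IsChordal.adj_of_joinedIn (hG : G.IsChordal) {P Q : Set V} {s t : V} (hst : s ≠ t)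
    (hPQ : Disjoint P Q) (hadj : ∀ x ∈ P, ∀ y ∈ Q, ¬ G.Adj x y) (hP : G.JoinedIn ({s, t} ∪ P) s t)
    (hQ : G.JoinedIn ({s, t} ∪ Q) s t) : G.Adj s t := by
  by_contra hnadj
  obtain ⟨k, p, p0, pk, pmem, hp⟩ := hP.exists_induced_path
  obtain ⟨m, q, q0, qm, qmem, hq⟩ := hQ.exists_induced_path
  have two_le : ∀ (k : ℕ) (p : ℕ → V), p 0 = s → p k = t →
      (∀ i j, i < j → j ≤ k → p i ≠ p j ∧ (G.Adj (p i) (p j) ↔ j = i + 1)) → 2 ≤ k := by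
    intro k p p0 pk hp
    by_contra hk
    obtain rfl | rfl : k = 0 ∨ k = 1 := by omega
    · exact hst (p0.symm.trans pk)
    · exact hnadj (by simpa [p0, pk] using (hp 0 1 one_pos le_rfl).2)
  have hk := two_le k p p0 pk hp
  have hm := two_le m q q0 qm hq
  have pin : ∀ i, 0 < i → i < k → p i ∈ P := by
    intro i h0 hi
    rcases pmem i hi.le with (h | h) | h
    · exact absurd (p0.trans h.symm) (hp 0 i h0 hi.le).1
    · exact absurd (h.trans pk.symm) (hp i k hi le_rfl).1
    · exact h
  have qin : ∀ i, 0 < i → i < m → q i ∈ Q := by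
    intro i h0 hi
    rcases qmem i hi.le with (h | h) | h
    · exact absurd (q0.trans h.symm) (hq 0 i h0 hi.le).1
    · exact absurd (h.trans qm.symm) (hq i m hi le_rfl).1
    · exact h
  refine hG (k + m) (by omega) (cycleGraph_isIndContained (by omega)
    (fun i => if i ≤ k then p i else q (k + m - i)) ?_)
  intro i j hij hj
  by_cases hjk : j ≤ k
  · have hik : i ≤ k := by omega
    have := hp i j hij hjk
    simp only [hik, hjk, if_true]
    refine ⟨this.1, this.2.trans ?_⟩
    omega
  by_cases hik : k ≤ i
  · -- both vertices lie on the second path, with `t` as its end `q m`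
    have hi : (if i ≤ k then p i else q (k + m - i)) = q (k + m - i) := by
      split_ifs with h
      · obtain rfl : i = k := by omega
        rw [pk, ← qm]
        congr 1
        omega
      · rfl
    simp only [hi, hjk, if_false]
    have := hq (k + m - j) (k + m - i) (by omega) (by omega)
    refine ⟨this.1.symm, (G.adj_comm _ _).trans (this.2.trans ?_)⟩
    omega
  have hik' : i ≤ k := by omega
  have hqj := qin (k + m - j) (by omega) (by omega)
  simp only [hik', hjk, if_true, if_false]
  rcases Nat.eq_zero_or_pos i with rfl | hi
  · have := hq 0 (k + m - j) (by omega) (by omega)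
    rw [p0, ← q0]
    refine ⟨this.1, this.2.trans ?_⟩
    omega
  · have hpi := pin i hi (by omega)
    refine ⟨fun h => Set.disjoint_left.1 hPQ hpi (h ▸ hqj), ?_⟩
    have := hadj _ hpi _ hqj
    constructor
    · exact fun h => absurd h this
    · omega

/-! ### Relations that describe interval representations -/

/-- `r` orders the vertices in `W` like the intervals of a representation of `G[W]`, where `r x y`
says that the interval of `x` lies entirely before that of `y`; no interval lies before
that of a vertex in `A` and none lies after that of a vertex in `B`. -/
structure IsPlacement (G : SimpleGraph V) (W A B : Set V) (r : V → V → Prop) : Prop where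
  mem : ∀ {x y}, r x y → x ∈ W ∧ y ∈ W
  adj_iff : ∀ x ∈ W, ∀ y ∈ W, x ≠ y → (G.Adj x y ↔ ¬ r x y ∧ ¬ r y x)
  irrefl : ∀ x, ¬ r x x
  ferrers : ∀ {a b c d}, r a b → r c d → r a d ∨ r c b
  left : ∀ a ∈ A, ∀ x, ¬ r x a
  right : ∀ b ∈ B, ∀ x, ¬ r b x

theorem IsPlacement.symm {W A B : Set V} {r : V → V → Prop} (h : G.IsPlacement W A B r) :
    G.IsPlacement W B A fun x y => r y x :=
  ⟨fun h' => (h.mem h').symm, fun x hx y hy hxy => (h.adj_iff x hx y hy hxy).trans and_comm,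
    h.irrefl, fun h₁ h₂ => (h.ferrers h₁ h₂).symm, h.right, h.left⟩

/-- Two placements that agree on a clique `S`, at the right end of one and at the left end of
the other, can be concatenated. -/
theorem IsPlacement.glue {P Q S A B : Set V} {r₁ r₂ : V → V → Prop}
    (hPQ : Disjoint P Q) (hPS : Disjoint P S) (hQS : Disjoint Q S)
    (hadj : ∀ x ∈ P, ∀ y ∈ Q, ¬ G.Adj x y) (hA : A ⊆ P ∪ S) (hB : B ⊆ Q ∪ S)
    (h₁ : G.IsPlacement (P ∪ S) A S r₁) (h₂ : G.IsPlacement (Q ∪ S) S B r₂) :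
    G.IsPlacement (P ∪ Q ∪ S) A B fun x y => r₁ x y ∨ r₂ x y ∨ (x ∈ P ∧ y ∈ Q) := by
  rw [Set.disjoint_left] at hPQ hPS hQS
  have s₁ : ∀ {x y}, r₁ x y → x ∈ P := fun {x y} h =>
    (h₁.mem h).1.resolve_right fun hx => h₁.right _ hx _ h
  have s₂ : ∀ {x y}, r₂ x y → y ∈ Q := fun {x y} h =>
    (h₂.mem h).2.resolve_right fun hx => h₂.left _ hx _ h
  have t₁ : ∀ {x y}, r₁ x y → y ∉ Q := fun {x y} h hy =>
    (h₁.mem h).2.elim (fun hp => hPQ hp hy) (fun hs => hQS hy hs)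
  have t₂ : ∀ {x y}, r₂ x y → x ∉ P := fun {x y} h hx =>
    (h₂.mem h).1.elim (fun hq => hPQ hx hq) (fun hs => hPS hx hs)
  constructor
  · rintro x y (h | h | h)
    · exact ⟨Or.inl (Or.inl (s₁ h)), (h₁.mem h).2.imp Or.inl id⟩
    · exact ⟨(h₂.mem h).1.imp Or.inr id, Or.inl (Or.inr (s₂ h))⟩
    · exact ⟨Or.inl (Or.inl h.1), Or.inl (Or.inr h.2)⟩
  · intro x hx y hy hxy
    have key₁ : x ∉ Q → y ∉ Q → (G.Adj x y ↔ ¬ r₁ x y ∧ ¬ r₁ y x) := fun hx' hy' =>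
      h₁.adj_iff x (hx.imp (fun h => h.resolve_right hx') id)
        y (hy.imp (fun h => h.resolve_right hy') id) hxy
    have key₂ : x ∉ P → y ∉ P → (G.Adj x y ↔ ¬ r₂ x y ∧ ¬ r₂ y x) := fun hx' hy' =>
      h₂.adj_iff x (hx.imp (fun h => h.resolve_left hx') id)
        y (hy.imp (fun h => h.resolve_left hy') id) hxy
    by_cases hxQ : x ∈ Q
    · by_cases hyP : y ∈ P
      · exact iff_of_false (fun h => hadj y hyP x hxQ h.symm) fun h => h.2 (.inr (.inr ⟨hyP, hxQ⟩))
      · have hxP : x ∉ P := fun h => hPQ h hxQ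
        rw [key₂ hxP hyP]
        have a : ¬ r₁ x y := fun h => hxP (s₁ h)
        have b : ¬ r₁ y x := fun h => hyP (s₁ h)
        tauto
    · by_cases hyQ : y ∈ Q
      · have hyP : y ∉ P := fun h => hPQ h hyQ
        by_cases hxP : x ∈ P
        · exact iff_of_false (hadj x hxP y hyQ) fun h => h.1 (.inr (.inr ⟨hxP, hyQ⟩))
        · rw [key₂ hxP hyP]
          have a : ¬ r₁ x y := fun h => hxP (s₁ h)
          have b : ¬ r₁ y x := fun h => hyP (s₁ h)
          tauto
      · rw [key₁ hxQ hyQ]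
        have a : ¬ r₂ x y := fun h => hyQ (s₂ h)
        have b : ¬ r₂ y x := fun h => hxQ (s₂ h)
        tauto
  · rintro x (h | h | h)
    · exact h₁.irrefl x h
    · exact h₂.irrefl x h
    · exact hPQ h.1 h.2
  · rintro a b c d (h | h | h) (h' | h' | h')
    · exact (h₁.ferrers h h').imp .inl .inl
    · exact .inl (.inr (.inr ⟨s₁ h, s₂ h'⟩))
    · exact .inl (.inr (.inr ⟨s₁ h, h'.2⟩))
    · exact .inr (.inr (.inr ⟨s₁ h', s₂ h⟩))
    · exact (h₂.ferrers h h').imp (.inr ∘ .inl) (.inr ∘ .inl)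
    · exact .inr (.inr (.inr ⟨h'.1, s₂ h⟩))
    · exact .inr (.inr (.inr ⟨s₁ h', h.2⟩))
    · exact .inl (.inr (.inr ⟨h.1, s₂ h'⟩))
    · exact .inl (.inr (.inr ⟨h.1, h'.2⟩))
  · rintro a ha x (h | h | h)
    · exact h₁.left a ha x h
    · exact (hA ha).elim (fun hp => hPQ hp (s₂ h)) fun hs => hQS (s₂ h) hs
    · exact (hA ha).elim (fun hp => hPQ hp h.2) fun hs => hQS h.2 hs
  · rintro b hb x (h | h | h)
    · exact (hB hb).elim (fun hq => hPQ (s₁ h) hq) fun hs => hPS (s₁ h) hs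
    · exact h₂.right b hb x h
    · exact (hB hb).elim (fun hq => hPQ h.1 hq) fun hs => hPS h.1 hs

/-- The interval of `x` starts at the number of predecessors of `x`, and ends before the first
number at which the interval of a successor starts. -/
theorem IsPlacement.isIntervalGraph [Finite V] {A B : Set V} {r : V → V → Prop}
    (h : G.IsPlacement Set.univ A B r) : G.IsIntervalGraph := by
  have hlt : ∀ x y z, r x y → ¬ r x z → (∀ c, r c z → r c y) →
      ({c | r c z}.ncard : ℝ) < {c | r c y}.ncard := by
    intro x y z hxy hxz hsub
    exact_mod_cast Set.ncard_lt_ncard (Set.ssubset_iff_of_subset hsub |>.2 ⟨x, hxy, hxz⟩)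
      (Set.toFinite _)
  have htrans : ∀ x y, r x y → ∀ c, r c x → r c y := fun x y hxy c hc =>
    (h.ferrers hc hxy).resolve_right (h.irrefl x)
  have hself : ∀ x y, r x y → ({c | r c x}.ncard : ℝ) < {c | r c y}.ncard := fun x y hxy =>
    hlt x y x hxy (h.irrefl x) (htrans x y hxy)
  refine ⟨fun x => {t | ({c | r c x}.ncard : ℝ) ≤ t ∧ ∀ y, r x y → t < {c | r c y}.ncard},
    fun x => ⟨⟨_, le_rfl, hself x⟩, ⟨fun s hs t ht z hz =>
      ⟨hs.1.trans hz.1, fun y hy => hz.2.trans_lt (ht.2 y hy)⟩⟩⟩, fun u v huv => ?_⟩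
  rw [h.adj_iff u trivial v trivial huv]
  constructor
  · rintro ⟨huv, hvu⟩
    -- the intervals of nonadjacent vertices meet where the later of them starts
    have meet : ∀ u v, ¬ r u v → ∀ y, r u y → ({c | r c v}.ncard : ℝ) < {c | r c y}.ncard :=
      fun u v huv y hy => hlt u y v hy huv fun c hc => (h.ferrers hc hy).resolve_right huv
    rcases le_total ({c | r c u}.ncard : ℝ) {c | r c v}.ncard with hle | hle
    · exact ⟨_, ⟨hle, meet u v huv⟩, le_rfl, hself v⟩
    · exact ⟨_, ⟨le_rfl, hself u⟩, hle, meet v u hvu⟩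
  · rintro ⟨t, ⟨hu, hu'⟩, hv, hv'⟩
    exact ⟨fun hr => (hu' v hr).not_ge hv, fun hr => (hv' u hr).not_ge hu⟩

/-! ### Asteroidal triples and interval graphs -/

/-- The vertices different from `v` and not adjacent to `v`. -/
def away (G : SimpleGraph V) (v : V) : Set V := {x | x ≠ v ∧ ¬ G.Adj v x}

theorem isAsteroidalTriple_of_joinedIn [DecidableEq V] {u v w : V}
    (huv : G.JoinedIn (G.away w) u v) (huw : G.JoinedIn (G.away v) u w)
    (hvw : G.JoinedIn (G.away u) v w) : G.IsAsteroidalTriple {u, v, w} := by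
  have key : ∀ {a b c : V}, G.JoinedIn (G.away c) a b →
      ∃ p : G.Walk a b, p.IsPath ∧ ∀ x ∈ p.support, x ∉ G.neighborSet c := by
    rintro a b c ⟨p, hp⟩
    exact ⟨p.bypass, p.bypass_isPath, fun x hx => (hp x (p.support_bypass_subset_support hx)).2⟩
  have h₁ := huv.left_mem
  have h₂ := huv.right_mem
  have h₃ := huw.left_mem
  refine ⟨Finset.card_eq_three.2 ⟨u, v, w, h₃.1, h₁.1, h₂.1, rfl⟩, ?_, ?_⟩
  · have n₁ := h₁.2
    have n₂ := h₂.2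
    have n₃ := h₃.2
    have n₁' := fun h : G.Adj u w => n₁ h.symm
    have n₂' := fun h : G.Adj v w => n₂ h.symm
    have n₃' := fun h : G.Adj u v => n₃ h.symm
    intro a ha b hb _
    simp only [Finset.coe_insert, Finset.coe_singleton, Set.mem_insert_iff,
      Set.mem_singleton_iff] at ha hb
    rcases ha with rfl | rfl | rfl <;> rcases hb with rfl | rfl | rfl <;>
      first | assumption | exact G.irrefl
  · intro a ha b hb c hc hab hac hbc
    simp only [Finset.mem_insert, Finset.mem_singleton] at ha hb hc
    rcases ha with rfl | rfl | rfl <;> rcases hb with rfl | rfl | rfl <;>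
      rcases hc with rfl | rfl | rfl <;>
      first
      | contradiction
      | exact key huv
      | exact key huw
      | exact key hvw
      | exact key huv.symm
      | exact key huw.symm
      | exact key hvw.symm

/-- A walk from the left of the interval of `w` to its right meets the closed neighborhood
of `w`. -/
theorem IsIntersectionGraph.not_lt_and_lt {I : V → Set ℝ} (hI : G.IsIntersectionGraph I)
    (hconn : ∀ v, (I v).OrdConnected) {u v w : V} (huw : u ≠ w)
    (h : G.JoinedIn {x | ¬ G.Adj w x} u v) {x y z : ℝ} (hx : x ∈ I u) (hy : y ∈ I v)
    (hz : z ∈ I w) : ¬ (x < z ∧ z < y) := by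
  rintro ⟨hxz, hzy⟩
  have notMem : ∀ a, a ≠ w → ¬ G.Adj w a → z ∉ I a := fun a ha hwa hza =>
    hwa ((hI w a ha.symm).2 ⟨z, hz, hza⟩)
  have before : ∀ a, a ≠ w → ¬ G.Adj w a → ∀ t ∈ I a, t < z → ∀ t' ∈ I a, t' < z := by
    intro a ha hwa t ht htz t' ht'
    by_contra hcon
    exact notMem a ha hwa ((hconn a).out ht ht' ⟨htz.le, not_lt.1 hcon⟩)
  have := h.of_closed (C := {a | (a ≠ w ∧ ¬ G.Adj w a) ∧ ∀ t ∈ I a, t < z}) ?_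
    ⟨⟨huw, h.left_mem⟩, before u huw h.left_mem x hx hxz⟩
  · exact lt_asymm hzy (this.right_mem.2 y hy)
  · rintro a ⟨⟨haw, hwa⟩, ha⟩ b hb hab
    have hbw : b ≠ w := by
      rintro rfl
      exact hwa hab.symm
    obtain ⟨t, hta, htb⟩ := (hI a b hab.ne).1 hab
    exact ⟨⟨hbw, hb⟩, before b hbw hb t htb (ha t hta)⟩

theorem IsIntervalGraph.not_isAsteroidalTriple (h : G.IsIntervalGraph) (s : Finset V) :
    ¬ G.IsAsteroidalTriple s := by
  classical
  rintro ⟨hcard, hind, hpath⟩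
  obtain ⟨I, hI, hint⟩ := h
  obtain ⟨u, v, w, huv, huw, hvw, rfl⟩ := Finset.card_eq_three.1 hcard
  obtain ⟨x, hx⟩ := (hI u).1
  obtain ⟨y, hy⟩ := (hI v).1
  obtain ⟨z, hz⟩ := (hI w).1
  have join : ∀ {a b c}, (∃ p : G.Walk a b, p.IsPath ∧ ∀ x ∈ p.support, x ∉ G.neighborSet c) →
      G.JoinedIn {x | ¬ G.Adj c x} a b := fun ⟨p, _, hp⟩ => ⟨p, hp⟩
  have huv' := join (hpath u (by simp) v (by simp) w (by simp) huv huw hvw)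
  have huw' := join (hpath u (by simp) w (by simp) v (by simp) huw huv hvw.symm)
  have hvw' := join (hpath v (by simp) w (by simp) u (by simp) hvw huv.symm huw.symm)
  have hdisj : ∀ {a b : V} {t t' : ℝ}, a ∈ ({u, v, w} : Finset V) → b ∈ ({u, v, w} : Finset V) →
      a ≠ b → t ∈ I a → t' ∈ I b → t ≠ t' := by
    rintro a b t _ ha hb hab hta htb rfl
    exact hind (by exact_mod_cast ha) (by exact_mod_cast hb) hab
      ((hint a b hab).2 ⟨t, hta, htb⟩)
  have hxy := hdisj (by simp) (by simp) huv hx hy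
  have hxz := hdisj (by simp) (by simp) huw hx hz
  have hyz := hdisj (by simp) (by simp) hvw hy hz
  have hconn := fun v => (hI v).2
  have m₁ := hint.not_lt_and_lt hconn huw huv' hx hy hz
  have m₂ := hint.not_lt_and_lt hconn hvw huv'.symm hy hx hz
  have m₃ := hint.not_lt_and_lt hconn huv huw' hx hz hy
  have m₄ := hint.not_lt_and_lt hconn hvw.symm huw'.symm hz hx hy
  have m₅ := hint.not_lt_and_lt hconn huv.symm hvw' hy hz hx
  have m₆ := hint.not_lt_and_lt hconn huw.symm hvw'.symm hz hy hx
  rcases lt_or_gt_of_ne hxy with a | a <;> rcases lt_or_gt_of_ne hxz with b | b <;>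
    rcases lt_or_gt_of_ne hyz with c | c <;> tauto

/-! ### Admissible cliques and full separators -/

/-- The conditions on the cliques `A` and `B` of `G[W]` that make a placement of `G[W]` with `A`
at the left end and `B` at the right end possible. Attach to `A` a path that runs out to the left,
and to `B` one that runs out to the right. Then `left` and `right` say that the far end of either
path lies in no asteroidal triple with two vertices of `W`, and `cross` that every path from one
far end to the other meets the closed neighborhood of every vertex of `W`. -/
structure IsAdmissible (G : SimpleGraph V) (W A B : Set V) : Prop where
  left_subset : A ⊆ W
  right_subset : B ⊆ W
  left_clique : G.IsClique A
  right_clique : G.IsClique B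
  left : ∀ {u v}, ∀ a ∈ A, ∀ a' ∈ A, G.JoinedIn (W ∩ G.away v) a u →
    ¬ G.JoinedIn (W ∩ G.away u) a' v
  right : ∀ {u v}, ∀ b ∈ B, ∀ b' ∈ B, G.JoinedIn (W ∩ G.away v) b u →
    ¬ G.JoinedIn (W ∩ G.away u) b' v
  cross : ∀ v ∈ W, ∀ a ∈ A, ∀ b ∈ B, ¬ G.JoinedIn (W ∩ G.away v) a b

theorem IsAdmissible.symm {W A B : Set V} (h : G.IsAdmissible W A B) : G.IsAdmissible W B A :=
  ⟨h.right_subset, h.left_subset, h.right_clique, h.left_clique, h.right, h.left,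
    fun v hv b hb a ha hj => h.cross v hv a ha b hb hj.symm⟩

theorem JoinedIn.of_isClique {X S : Set V} {s t : V} (hS : G.IsClique S) (hs : s ∈ S) (ht : t ∈ S)
    (hsX : s ∈ X) (htX : t ∈ X) : G.JoinedIn X s t := by
  by_cases hst : s = t
  · exact hst ▸ refl hsX
  · exact of_adj hsX htX (hS hs ht hst)

/-- A clique `S` such that `G[W \ S]` is disconnected and every vertex of `S` has a neighbor in
every component of `G[W \ S]`. -/
structure IsFullSeparator (G : SimpleGraph V) (W S : Set V) : Prop where
  subset : S ⊆ W
  clique : G.IsClique S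
  separates : ∃ u ∈ W \ S, ∃ v ∈ W \ S, ¬ G.JoinedIn (W \ S) u v
  full : ∀ s ∈ S, ∀ u ∈ W \ S, ∃ x, G.JoinedIn (W \ S) u x ∧ G.Adj s x

/-- In a chordal graph, a separating set of minimal size is a clique. -/
theorem IsChordal.exists_isFullSeparator [Finite V] (hG : G.IsChordal) {W : Set V}
    (hW : ¬ G.IsClique W) : ∃ S, G.IsFullSeparator W S := by
  classical
  let Sep : Set V → Prop := fun S => S ⊆ W ∧ ∃ u ∈ W \ S, ∃ v ∈ W \ S, ¬ G.JoinedIn (W \ S) u v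
  have hex : ∃ S, Sep S := by
    simp only [IsClique, Set.Pairwise, not_forall] at hW
    obtain ⟨x, hx, y, hy, hxy, hadj⟩ := hW
    refine ⟨W \ {x, y}, Set.sdiff_subset, x, by simp [hx], y, by simp [hy], fun h => ?_⟩
    have := h.of_closed (C := {x}) ?_ rfl
    · exact hxy this.right_mem.symm
    · rintro w (hw : w = x) z hz hxz
      rw [hw] at hxz
      have hz' : z = x ∨ z = y := by
        by_contra hne
        exact hz.2 ⟨hz.1, hne⟩
      rcases hz' with rfl | rfl
      · rfl
      · exact absurd hxz hadj
  obtain ⟨S, ⟨hSW, u, hu, v, hv, huv⟩, hmin⟩ :=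
    Set.exists_min_image {S | Sep S} Set.ncard (Set.toFinite _) hex
  have full : ∀ s ∈ S, ∀ u ∈ W \ S, ∃ x, G.JoinedIn (W \ S) u x ∧ G.Adj s x := by
    intro s hs w hw
    by_contra! hcon
    obtain ⟨w', hw', hww'⟩ : ∃ w' ∈ W \ S, ¬ G.JoinedIn (W \ S) w w' := by
      by_contra! hall
      exact huv ((hall u hu).symm.trans (hall v hv))
    -- if `s` has no neighbor in the component of `w`, then `S \ {s}` still separates it from `w'`
    refine (Set.ncard_sdiff_singleton_lt_of_mem hs).not_ge (hmin (S \ {s})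
      ⟨Set.sdiff_subset.trans hSW, w, ⟨hw.1, fun h => hw.2 h.1⟩, w',
        ⟨hw'.1, fun h => hw'.2 h.1⟩, fun hj => ?_⟩)
    refine hww' (hj.of_closed (C := {x | G.JoinedIn (W \ S) w x}) ?_ (.refl hw)).right_mem
    intro x hx y hy hxy
    by_cases hyS : y ∈ S
    · have : y = s := by
        by_contra hne
        exact hy.2 ⟨hyS, hne⟩
      exact absurd (this ▸ hxy).symm (hcon x hx)
    · exact hx.trans (.of_adj hx.right_mem ⟨hy.1, hyS⟩ hxy)
  refine ⟨S, hSW, fun s hs t ht hst => ?_, ⟨u, hu, v, hv, huv⟩, full⟩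
  have through : ∀ w ∈ W \ S, G.JoinedIn ({s, t} ∪ {x | G.JoinedIn (W \ S) w x}) s t := by
    intro w hw
    obtain ⟨x, hx, hsx⟩ := full s hs w hw
    obtain ⟨y, hy, hty⟩ := full t ht w hw
    exact (JoinedIn.of_adj (by simp) (.inr hx) hsx).trans
      (((hx.in_component.symm.trans hy.in_component).mono Set.subset_union_right).trans
        (.of_adj (.inr hy) (by simp) hty.symm))
  refine hG.adj_of_joinedIn hst ?_ ?_ (through u hu) (through v hv)
  · exact Set.disjoint_left.2 fun x hx hx' => huv (JoinedIn.trans hx (JoinedIn.symm hx'))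
  · exact fun x hx y hy hxy => huv ((JoinedIn.trans hx (.of_adj hx.right_mem hy.right_mem hxy)).trans
      (JoinedIn.symm hy))

/-! ### The two sides of a separator -/

/-- `v` can be avoided on the way from `A` to the separator `S`. Thus `v` cannot be placed
between `A` and `S`. -/
def Avoidable (G : SimpleGraph V) (W S A : Set V) (v : V) : Prop :=
  ∃ a ∈ A, ∃ s ∈ S, G.JoinedIn (W ∩ G.away v) a s

/-- `x` has to be placed on the side of the separator `S` on which `A` is: either `x` lies in `A`,
or `x` cannot be placed between `S` and the clique `B` at the opposite end. -/
def Forced (G : SimpleGraph V) (W S A B : Set V) (x : V) : Prop :=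
  x ∈ W \ S ∧ (x ∈ A ∨ G.Avoidable W S B x)

namespace IsFullSeparator

variable {W S A B : Set V} {x y z s : V}

theorem away_of_joinedIn (hxy : ¬ G.JoinedIn (W \ S) x y) (hx : x ∈ W \ S)
    (hyz : G.JoinedIn (W \ S) y z) : z ∈ G.away x := by
  refine ⟨?_, fun h => hxy ((JoinedIn.of_adj hx hyz.right_mem h).trans hyz.symm)⟩
  rintro rfl
  exact hxy hyz.symm

theorem joinedIn_away (hxy : ¬ G.JoinedIn (W \ S) x y) (hx : x ∈ W \ S)
    (hyz : G.JoinedIn (W \ S) y z) : G.JoinedIn (W ∩ G.away x) y z :=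
  hyz.in_component.mono fun _ hw => ⟨(JoinedIn.right_mem hw).1, away_of_joinedIn hxy hx hw⟩

theorem joinedIn_away_sep (hS : G.IsFullSeparator W S) (hs : s ∈ S) (hsx : s ∈ G.away x)
    (hxy : ¬ G.JoinedIn (W \ S) x y) (hx : x ∈ W \ S) (hy : y ∈ W \ S) :
    G.JoinedIn (W ∩ G.away x) s y := by
  obtain ⟨z, hyz, hsz⟩ := hS.full s hs y hy
  exact (JoinedIn.of_adj (X := W ∩ G.away x) ⟨hS.subset hs, hsx⟩
    ⟨hyz.right_mem.1, away_of_joinedIn hxy hx hyz⟩ hsz).trans (joinedIn_away hxy hx hyz).symm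

theorem exists_mem_away (h : G.Avoidable W S A x) : ∃ s ∈ S, s ∈ G.away x := by
  obtain ⟨a, _, s, hs, has⟩ := h
  exact ⟨s, hs, has.right_mem.2⟩

theorem joinedIn_of_avoidable (hS : G.IsFullSeparator W S) (hA : G.IsAdmissible W A B)
    (hx : x ∈ W \ S) (hy : y ∈ W \ S) (hx' : G.Avoidable W S A x) (hy' : G.Avoidable W S A y) :
    G.JoinedIn (W \ S) x y := by
  by_contra hxy
  obtain ⟨a, ha, s, hs, has⟩ := hx'
  obtain ⟨a', ha', s', hs', has'⟩ := hy'
  exact hA.left a ha a' ha' (has.trans (hS.joinedIn_away_sep hs has.right_mem.2 hxy hx hy))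
    (has'.trans (hS.joinedIn_away_sep hs' has'.right_mem.2 (fun h => hxy h.symm) hy hx))

theorem avoidable_of_mem (hS : G.IsFullSeparator W S) (hx : x ∈ W \ S) (hy : y ∈ W \ S)
    (hxy : ¬ G.JoinedIn (W \ S) x y) (hyA : y ∈ A) (hs : s ∈ S) (hsx : s ∈ G.away x) :
    G.Avoidable W S A x :=
  ⟨y, hyA, s, hs, (hS.joinedIn_away_sep hs hsx hxy hx hy).symm⟩

theorem joinedIn_of_forced (hS : G.IsFullSeparator W S) (hA : G.IsAdmissible W A B)
    (hx : G.Forced W S A B x) (hy : G.Forced W S A B y) : G.JoinedIn (W \ S) x y := by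
  have mixed : ∀ {x y}, x ∈ W \ S → y ∈ W \ S → x ∈ A → G.Avoidable W S B y →
      G.JoinedIn (W \ S) y x := by
    rintro x y hx hy hxA ⟨b, hb, s, hs, hbs⟩
    by_contra hyx
    exact hA.cross y hy.1 x hxA b hb
      (hbs.trans (hS.joinedIn_away_sep hs hbs.right_mem.2 hyx hy hx)).symm
  obtain ⟨hx, hx' | hx'⟩ := hx <;> obtain ⟨hy, hy' | hy'⟩ := hy
  · exact .of_isClique hA.left_clique hx' hy' hx hy
  · exact (mixed hx hy hx' hy').symm
  · exact mixed hy hx hy' hx'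
  · exact hS.joinedIn_of_avoidable hA.symm hx hy hx' hy'

/-- If `A` meets the component of `x` and `y`, then `y` cannot be avoided on the way from `A` to
`S`: otherwise `y` and a vertex `z` of another component would violate the condition on `A`. -/
theorem not_avoidable_of_mem (hS : G.IsFullSeparator W S) (hA : G.IsAdmissible W A B)
    (hxy : G.JoinedIn (W \ S) x y) (hz : z ∈ W \ S) (hxz : ¬ G.JoinedIn (W \ S) x z)
    (hxA : x ∈ A) : ¬ G.Avoidable W S A y := by
  rintro ⟨a, ha, s, hs, has⟩
  exact hA.left a ha x hxA (has.trans (hS.joinedIn_away_sep hs has.right_mem.2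
    (fun h => hxz (hxy.trans h)) hxy.right_mem hz)) (joinedIn_away (fun h => hxz h.symm) hz hxy)

theorem subset_of_avoidable (hS : G.IsFullSeparator W S) (hA : G.IsAdmissible W A B)
    (hxy : G.JoinedIn (W \ S) x y) (hz : z ∈ W \ S) (hxz : ¬ G.JoinedIn (W \ S) x z)
    (hs : s ∈ S) (hsx : s ∈ G.away x) (hx : ¬ G.Avoidable W S A x)
    (hy : G.Avoidable W S A y) : A ⊆ S := by
  intro a ha
  by_contra haS
  have haW : a ∈ W \ S := ⟨hA.left_subset ha, haS⟩
  by_cases hxa : G.JoinedIn (W \ S) x a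
  · exact hS.not_avoidable_of_mem hA (hxa.symm.trans hxy) hz (fun h => hxz (hxa.trans h)) ha hy
  · exact hx (hS.avoidable_of_mem hxy.left_mem haW hxa ha hs hsx)

/-- The opposite sides of the separator are never forced on vertices of one component. -/
theorem not_joinedIn_of_forced (hG : G.IsChordal)
    (hAT : ¬ ∃ s : Finset V, G.IsAsteroidalTriple s) (hS : G.IsFullSeparator W S)
    (hA : G.IsAdmissible W A B) (hx : G.Forced W S A B x) (hy : G.Forced W S B A y) :
    ¬ G.JoinedIn (W \ S) x y := by
  classical
  intro hxy
  obtain ⟨z, hz, hxz⟩ : ∃ z ∈ W \ S, ¬ G.JoinedIn (W \ S) x z := by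
    by_contra! hall
    obtain ⟨u, hu, v, hv, huv⟩ := hS.separates
    exact huv ((hall u hu).symm.trans (hall v hv))
  have hyz : ¬ G.JoinedIn (W \ S) y z := fun h => hxz (hxy.trans h)
  obtain ⟨hxW, hxA | hxB⟩ := hx
  · obtain ⟨hyW, hyB | hyA⟩ := hy
    · exact hA.cross z hz.1 x hxA y hyB (joinedIn_away (fun h => hxz h.symm) hz hxy)
    · exact hS.not_avoidable_of_mem hA hxy hz hxz hxA hyA
  obtain ⟨hyW, hyB | hyA⟩ := hy
  · exact hS.not_avoidable_of_mem hA.symm hxy.symm hz hyz hyB hxB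
  have not_both : ∀ w ∈ W \ S, G.Avoidable W S A w → ¬ G.Avoidable W S B w := by
    rintro w hw ⟨a, ha, s, hs, has⟩ ⟨b, hb, t, ht, hbt⟩
    exact hA.cross w hw.1 a ha b hb (has.trans
      ((JoinedIn.of_isClique hS.clique hs ht has.right_mem hbt.right_mem).trans hbt.symm))
  have hxA : ¬ G.Avoidable W S A x := fun h => not_both x hxW h hxB
  have hyB : ¬ G.Avoidable W S B y := not_both y hyW hyA
  obtain ⟨s, hs, hsx⟩ := exists_mem_away hxB
  obtain ⟨t, ht, hty⟩ := exists_mem_away hyA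
  have hAS := hS.subset_of_avoidable hA hxy hz hxz hs hsx hxA hyA
  have hBS := hS.subset_of_avoidable hA.symm hxy.symm hz hyz ht hty hyB hxB
  obtain ⟨a, haA, hay⟩ : ∃ a ∈ A, a ∈ G.away y := by
    obtain ⟨a, haA, _, _, has⟩ := hyA
    exact ⟨a, haA, has.left_mem.2⟩
  obtain ⟨b, hbB, hbx⟩ : ∃ b ∈ B, b ∈ G.away x := by
    obtain ⟨b, hbB, _, _, hbs⟩ := hxB
    exact ⟨b, hbB, hbs.left_mem.2⟩
  have ha := hAS haA
  have hb := hBS hbB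
  -- `x, a, b, y` is a path with no chord except possibly `x y`
  have hxa : G.Adj x a := by
    by_contra h
    have haW : a ∈ W ∩ G.away x := ⟨hS.subset ha, fun h' => hxW.2 (h' ▸ ha), h⟩
    exact hxA ⟨a, haA, a, ha, .refl haW⟩
  have hyb : G.Adj y b := by
    by_contra h
    have hbW : b ∈ W ∩ G.away y := ⟨hS.subset hb, fun h' => hyW.2 (h' ▸ hb), h⟩
    exact hyB ⟨b, hbB, b, hb, .refl hbW⟩
  have hab : G.Adj a b := hS.clique ha hb fun h => hbx.2 (h ▸ hxa)
  have hne : x ≠ y := fun h => hay.2 (h ▸ hxa)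
  by_cases hadj : G.Adj x y
  · -- the hole `x, a, b, y`
    refine hbx.2 (hG.adj_of_joinedIn (P := {y}) (Q := {a}) hbx.1.symm ?_ ?_ ?_ ?_)
    · exact Set.disjoint_singleton.2 hay.1.symm
    · rintro _ rfl _ rfl
      exact hay.2
    · exact (JoinedIn.of_adj (by simp) (by simp) hadj).trans (.of_adj (by simp) (by simp) hyb)
    · exact (JoinedIn.of_adj (by simp) (by simp) hxa).trans (.of_adj (by simp) (by simp) hab)
  · refine hAT ⟨_, isAsteroidalTriple_of_joinedIn (u := x) (v := y) (w := z)
      ((joinedIn_away (fun h => hxz h.symm) hz hxy).mono Set.inter_subset_right) ?_ ?_⟩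
    · exact (JoinedIn.of_adj (X := G.away y) ⟨hne, fun h => hadj h.symm⟩ hay hxa).trans
        ((hS.joinedIn_away_sep ha hay hyz hyW hz).mono Set.inter_subset_right)
    · exact (JoinedIn.of_adj (X := G.away x) ⟨hne.symm, hadj⟩ hbx hyb).trans
        ((hS.joinedIn_away_sep hb hbx hxz hxW hz).mono Set.inter_subset_right)

/-- At most two components contain a vertex that is not adjacent to all of `S`. -/
theorem joinedIn_or_joinedIn (hAT : ¬ ∃ s : Finset V, G.IsAsteroidalTriple s)
    (hS : G.IsFullSeparator W S) (hx : x ∈ W \ S) (hy : y ∈ W \ S) (hz : z ∈ W \ S)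
    (hx' : ∃ s ∈ S, s ∈ G.away x) (hy' : ∃ s ∈ S, s ∈ G.away y) (hz' : ∃ s ∈ S, s ∈ G.away z)
    (hxy : ¬ G.JoinedIn (W \ S) x y) : G.JoinedIn (W \ S) z x ∨ G.JoinedIn (W \ S) z y := by
  classical
  by_contra! hcon
  have join : ∀ {a b c}, a ∈ W \ S → b ∈ W \ S → c ∈ W \ S → (∃ s ∈ S, s ∈ G.away c) →
      ¬ G.JoinedIn (W \ S) c a → ¬ G.JoinedIn (W \ S) c b → G.JoinedIn (G.away c) a b := by
    rintro a b c ha hb hc ⟨s, hs, hsc⟩ hca hcb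
    exact ((hS.joinedIn_away_sep hs hsc hca hc ha).symm.trans
      (hS.joinedIn_away_sep hs hsc hcb hc hb)).mono Set.inter_subset_right
  exact hAT ⟨_, isAsteroidalTriple_of_joinedIn (join hx hy hz hz' hcon.1 hcon.2)
    (join hx hz hy hy' (fun h => hxy h.symm) fun h => hcon.2 h.symm)
    (join hy hz hx hx' hxy fun h => hcon.1 h.symm)⟩

theorem forced_of_mem_away (hS : G.IsFullSeparator W S) (hx : x ∈ W \ S)
    (hx' : ∃ s ∈ S, s ∈ G.away x) (hy : G.Forced W S A B y) (hxy : ¬ G.JoinedIn (W \ S) x y) :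
    G.Forced W S B A x ∨ ∃ s ∈ S, s ∈ G.away y := by
  obtain ⟨hy, hyA | hyB⟩ := hy
  · obtain ⟨s, hs, hsx⟩ := hx'
    exact .inl ⟨hx, .inr (hS.avoidable_of_mem hx hy hxy hyA hs hsx)⟩
  · exact .inr (exists_mem_away hyB)

/-- Two different components, of `l` and of `r`, can be chosen as the left and the right side
of `S`: all other components are complete to `S`. -/
theorem exists_sides (hG : G.IsChordal) (hAT : ¬ ∃ s : Finset V, G.IsAsteroidalTriple s)
    (hS : G.IsFullSeparator W S) (hA : G.IsAdmissible W A B) :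
    ∃ l ∈ W \ S, ∃ r ∈ W \ S, ¬ G.JoinedIn (W \ S) l r ∧
      (∀ x, G.Forced W S A B x → G.JoinedIn (W \ S) x l) ∧
      (∀ x, G.Forced W S B A x → G.JoinedIn (W \ S) x r) ∧
      ∀ x ∈ W \ S, (∃ s ∈ S, s ∈ G.away x) →
        G.JoinedIn (W \ S) x l ∨ G.JoinedIn (W \ S) x r := by
  have other : ∀ l, ∃ r ∈ W \ S, ¬ G.JoinedIn (W \ S) l r := by
    by_contra! ⟨l, hall⟩
    obtain ⟨u, hu, v, hv, huv⟩ := hS.separates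
    exact huv ((hall u hu).symm.trans (hall v hv))
  -- with nothing forced to one side, that side is free for a component not complete to `S`
  have free : ∀ A B, (∀ x, ¬ G.Forced W S B A x) → ∀ l ∈ W \ S,
      (G.Forced W S A B l ∨ (∃ s ∈ S, s ∈ G.away l) ∨ ∀ x ∈ W \ S, ¬ ∃ s ∈ S, s ∈ G.away x) →
      ∃ r ∈ W \ S, ¬ G.JoinedIn (W \ S) l r ∧ ∀ x ∈ W \ S, (∃ s ∈ S, s ∈ G.away x) →
        G.JoinedIn (W \ S) x l ∨ G.JoinedIn (W \ S) x r := by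
    intro A B hB l hl hl'
    by_cases h : ∃ r ∈ W \ S, (∃ s ∈ S, s ∈ G.away r) ∧ ¬ G.JoinedIn (W \ S) l r
    · obtain ⟨r, hr, hr', hlr⟩ := h
      refine ⟨r, hr, hlr, fun x hx hx' => ?_⟩
      have hl'' : ∃ s ∈ S, s ∈ G.away l := by
        rcases hl' with hl' | hl' | hl'
        · exact (hS.forced_of_mem_away hr hr' hl' fun h => hlr h.symm).resolve_left (hB r)
        · exact hl'
        · exact absurd hr' (hl' r hr)
      exact hS.joinedIn_or_joinedIn hAT hl hr hx hl'' hr' hx' hlr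
    · push Not at h
      obtain ⟨r, hr, hlr⟩ := other l
      exact ⟨r, hr, hlr, fun x hx ⟨s, hs, hsx⟩ => .inl (h x hx ⟨s, hs, hsx⟩).symm⟩
  by_cases hL : ∃ l, G.Forced W S A B l
  · obtain ⟨l, hl⟩ := hL
    by_cases hR : ∃ r, G.Forced W S B A r
    · obtain ⟨r, hr⟩ := hR
      have hlr := hS.not_joinedIn_of_forced hG hAT hA hl hr
      refine ⟨l, hl.1, r, hr.1, hlr, fun x hx => hS.joinedIn_of_forced hA hx hl,
        fun x hx => hS.joinedIn_of_forced hA.symm hx hr, fun x hx hx' => ?_⟩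
      by_contra! hcon
      rcases hS.forced_of_mem_away hx hx' hl hcon.1 with h | hl'
      · exact hcon.2 (hS.joinedIn_of_forced hA.symm h hr)
      rcases hS.forced_of_mem_away hx hx' hr hcon.2 with h | hr'
      · exact hcon.1 (hS.joinedIn_of_forced hA h hl)
      exact (hS.joinedIn_or_joinedIn hAT hl.1 hr.1 hx hl' hr' hx' hlr).elim hcon.1 hcon.2
    · rw [not_exists] at hR
      obtain ⟨r, hr, hlr, h⟩ := free A B hR l hl.1 (.inl hl)
      exact ⟨l, hl.1, r, hr, hlr, fun x hx => hS.joinedIn_of_forced hA hx hl,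
        fun x hx => absurd hx (hR x), h⟩
  rw [not_exists] at hL
  -- the right side is chosen first
  obtain ⟨r, hr, hforced, hr'⟩ : ∃ r ∈ W \ S, (∀ x, G.Forced W S B A x → G.JoinedIn (W \ S) x r) ∧
      (G.Forced W S B A r ∨ (∃ s ∈ S, s ∈ G.away r) ∨
        ∀ x ∈ W \ S, ¬ ∃ s ∈ S, s ∈ G.away x) := by
    by_cases hR : ∃ r, G.Forced W S B A r
    · obtain ⟨r, hr⟩ := hR
      exact ⟨r, hr.1, fun x hx => hS.joinedIn_of_forced hA.symm hx hr, .inl hr⟩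
    rw [not_exists] at hR
    by_cases h : ∃ r ∈ W \ S, ∃ s ∈ S, s ∈ G.away r
    · obtain ⟨r, hr, hr'⟩ := h
      exact ⟨r, hr, fun x hx => absurd hx (hR x), .inr (.inl hr')⟩
    · obtain ⟨r, hr, -⟩ := hS.separates
      exact ⟨r, hr, fun x hx => absurd hx (hR x), .inr (.inr fun x hx hx' => h ⟨x, hx, hx'⟩)⟩
  obtain ⟨l, hl, hrl, h⟩ := free B A hL r hr hr'
  exact ⟨l, hl, r, hr, fun h => hrl h.symm, fun x hx => absurd hx (hL x), hforced,
    fun x hx hx' => (h x hx hx').symm⟩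

/-! ### The induction -/

/-- The component of `l` together with `S` is again admissible, with `A` at the left end and `S`
at the right end. -/
theorem isAdmissible_side (hAT : ¬ ∃ s : Finset V, G.IsAsteroidalTriple s)
    (hS : G.IsFullSeparator W S) (hA : G.IsAdmissible W A B) {l r : V} (hr : r ∈ W \ S)
    (hlr : ¬ G.JoinedIn (W \ S) l r)
    (hL : ∀ x, G.Forced W S A B x → G.JoinedIn (W \ S) x l)
    (hR : ∀ x, G.Forced W S B A x → G.JoinedIn (W \ S) x r) :
    G.IsAdmissible ({x | G.JoinedIn (W \ S) l x} ∪ S) A S := by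
  classical
  have hsub : {x | G.JoinedIn (W \ S) l x} ∪ S ⊆ W :=
    Set.union_subset (fun x hx => hx.right_mem.1) hS.subset
  have hmono : ∀ v, ({x | G.JoinedIn (W \ S) l x} ∪ S) ∩ G.away v ⊆ W ∩ G.away v :=
    fun v => Set.inter_subset_inter_left _ hsub
  have mem : ∀ v ∈ {x | G.JoinedIn (W \ S) l x} ∪ S, ∀ s ∈ S, s ∈ G.away v →
      G.JoinedIn (W \ S) l v := fun v hv s hs hsv =>
    hv.resolve_right fun hvS => hsv.2 (hS.clique hvS hs hsv.1.symm)
  refine ⟨fun a ha => ?_, Set.subset_union_right, hA.left_clique, hS.clique,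
    fun a ha a' ha' h h' => hA.left a ha a' ha' (h.mono (hmono _)) (h'.mono (hmono _)),
    fun {u v} s hs s' hs' h h' => ?_, fun v hv a ha s hs h => ?_⟩
  · by_cases haS : a ∈ S
    · exact .inr haS
    · exact .inl (hL a ⟨⟨hA.left_subset ha, haS⟩, .inl ha⟩).symm
  · have hu := mem u h.right_mem.1 s' hs' h'.left_mem.2
    have hv := mem v h'.right_mem.1 s hs h.left_mem.2
    exact hAT ⟨_, isAsteroidalTriple_of_joinedIn (u := u) (v := v) (w := r)
      ((joinedIn_away (fun h => hlr (hu.trans h.symm)) hr (hu.symm.trans hv)).mono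
        Set.inter_subset_right)
      ((h.symm.mono ((hmono _).trans Set.inter_subset_right)).trans ((hS.joinedIn_away_sep hs
        h.left_mem.2 (fun h => hlr (hv.trans h)) hv.right_mem hr).mono Set.inter_subset_right))
      ((h'.symm.mono ((hmono _).trans Set.inter_subset_right)).trans ((hS.joinedIn_away_sep hs'
        h'.left_mem.2 (fun h => hlr (hu.trans h)) hu.right_mem hr).mono Set.inter_subset_right))⟩
  · have hlv := mem v hv s hs h.right_mem.2
    exact hlr (hlv.trans (hR v ⟨hlv.right_mem, .inr ⟨a, ha, s, hs, h.mono (hmono _)⟩⟩))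

/-- A set of vertices complete to `S` is admissible with `S` at both ends. -/
theorem isAdmissible_middle (hS : G.IsClique S) {M : Set V}
    (hM : ∀ x ∈ M, ∀ s ∈ S, s ∉ G.away x) : G.IsAdmissible (M ∪ S) S S := by
  have none : ∀ v ∈ M ∪ S, ∀ s ∈ S, s ∉ G.away v := by
    rintro v (hv | hv) s hs hsv
    · exact hM v hv s hs hsv
    · exact hsv.2 (hS hv hs hsv.1.symm)
  exact ⟨Set.subset_union_right, Set.subset_union_right, hS, hS,
    fun s hs s' hs' h h' => none _ h'.right_mem.1 s hs h.left_mem.2,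
    fun s hs s' hs' h h' => none _ h'.right_mem.1 s hs h.left_mem.2,
    fun v hv s hs s' hs' h => none v hv s hs h.left_mem.2⟩

end IsFullSeparator

/-- A placement is put together from placements of the left side, of the
middle components and of the right side of a full separator. -/
theorem IsAdmissible.exists_isPlacement [Finite V] (hG : G.IsChordal)
    (hAT : ¬ ∃ s : Finset V, G.IsAsteroidalTriple s) {W A B : Set V}
    (hA : G.IsAdmissible W A B) : ∃ r, G.IsPlacement W A B r := by
  induction hn : W.ncard using Nat.strong_induction_on generalizing W A B with
  | _ n ih =>
  subst hn
  by_cases hW : G.IsClique W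
  · exact ⟨fun _ _ => False, False.elim, fun x hx y hy hxy => iff_of_true (hW hx hy hxy) (by simp),
      fun _ => id, fun h => h.elim, fun _ _ _ => id, fun _ _ _ => id⟩
  obtain ⟨S, hS⟩ := hG.exists_isFullSeparator hW
  obtain ⟨l, hl, r, hr, hlr, hL, hR, hM⟩ := hS.exists_sides hG hAT hA
  set PL := {x | G.JoinedIn (W \ S) l x} with hPL
  set PR := {x | G.JoinedIn (W \ S) r x} with hPR
  set M := {x | x ∈ W \ S ∧ x ∉ PL ∧ x ∉ PR} with hMdef
  have hlPL : l ∈ PL := .refl hl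
  have hrPR : r ∈ PR := .refl hr
  have subL : PL ⊆ W \ S := fun x hx => JoinedIn.right_mem hx
  have subR : PR ⊆ W \ S := fun x hx => JoinedIn.right_mem hx
  have subM : M ⊆ W \ S := fun x hx => hx.1
  have disjS : ∀ {P}, P ⊆ W \ S → Disjoint P S := fun h =>
    Set.disjoint_left.2 fun x hx => (h hx).2
  have disjLR : Disjoint PL PR := Set.disjoint_left.2 fun x hx hx' =>
    hlr (JoinedIn.trans hx (JoinedIn.symm hx'))
  have disjLM : Disjoint PL M := Set.disjoint_left.2 fun x hx hx' => hx'.2.1 hx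
  have disjMR : Disjoint M PR := Set.disjoint_left.2 fun x hx hx' => hx.2.2 hx'
  have closed : ∀ c, ∀ x ∈ W \ S, ¬ G.JoinedIn (W \ S) c x → ∀ y, G.JoinedIn (W \ S) c y →
      ¬ G.Adj x y := fun c x hx hcx y hcy hxy =>
    hcx (hcy.trans (.of_adj hcy.right_mem hx hxy.symm))
  have small : ∀ {P v}, P ⊆ W \ S → v ∈ W \ S → v ∉ P → (P ∪ S).ncard < W.ncard := by
    intro P v hP hv hvP
    refine Set.ncard_lt_ncard ((Set.ssubset_iff_of_subset
      (Set.union_subset (hP.trans Set.sdiff_subset) hS.subset)).2 ⟨v, hv.1, ?_⟩) (Set.toFinite _)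
    exact fun h => h.elim hvP hv.2
  have adL := hS.isAdmissible_side hAT hA hr hlr hL hR
  have adR := hS.isAdmissible_side hAT hA.symm hl (fun h => hlr h.symm) hR hL
  have adM : G.IsAdmissible (M ∪ S) S S :=
    IsFullSeparator.isAdmissible_middle hS.clique
    fun x hx s hs hsx => (hM x hx.1 ⟨s, hs, hsx⟩).elim (fun h => hx.2.1 h.symm)
      fun h => hx.2.2 h.symm
  obtain ⟨r₁, h₁⟩ := ih _ (small subL hr fun h => Set.disjoint_left.1 disjLR h hrPR) adL rfl
  obtain ⟨r₂, h₂⟩ := ih _ (small subM hl fun h => h.2.1 hlPL) adM rfl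
  obtain ⟨r₃, h₃⟩ := ih _ (small subR hl fun h => Set.disjoint_left.1 disjLR hlPL h) adR rfl
  have hMR := h₂.glue disjMR (disjS subM) (disjS subR)
    (fun x hx y hy => closed r x hx.1 hx.2.2 y hy) Set.subset_union_right adR.left_subset h₃.symm
  have hLMR := h₁.glue (Disjoint.union_right disjLM disjLR) (disjS subL)
    (disjS (Set.union_subset subM subR)) ?_ adL.left_subset ?_ hMR
  · have hW' : PL ∪ (M ∪ PR) ∪ S = W := by
      ext x
      constructor
      · rintro ((h | h | h) | h)
        exacts [(subL h).1, (subM h).1, (subR h).1, hS.subset h]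
      · intro hx
        by_cases hxS : x ∈ S
        · exact .inr hxS
        by_cases hxL : x ∈ PL
        · exact .inl (.inl hxL)
        by_cases hxR : x ∈ PR
        · exact .inl (.inr (.inr hxR))
        · exact .inl (.inr (.inl ⟨⟨hx, hxS⟩, hxL, hxR⟩))
    exact ⟨_, hW' ▸ hLMR⟩
  · intro x hx y hy hxy
    refine closed l y ?_ ?_ x hx hxy.symm
    · exact hy.elim (fun h => subM h) fun h => subR h
    · exact hy.elim (fun h => h.2.1) fun h h' => Set.disjoint_left.1 disjLR h' h
  · exact adR.left_subset.trans (Set.union_subset_union_left _ Set.subset_union_right)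

end SimpleGraph

theorem theorem1 {V : Type*} [Finite V] (G : SimpleGraph V) (hG : G.IsChordal) :
    G.IsIntervalGraph ↔ ¬ ∃ s : Finset V, G.IsAsteroidalTriple s := by
  refine ⟨fun h ⟨s, hs⟩ => h.not_isAsteroidalTriple s hs, fun hAT => ?_⟩
  have hadm : G.IsAdmissible Set.univ ∅ ∅ := by constructor <;> simp
  obtain ⟨r, hr⟩ := hadm.exists_isPlacement hG hAT
  exact hr.isIntervalGraph
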